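/- Fix $N\ge 2$. For a family $\mathcal P$ of noncommutative polynomials in $z_1,\dots,z_N,z_1^*,\dots,z_N^*$ with complex coefficients, let $X_{\mathcal P}$ be the noncommutative space whose algebra $C(X_{\mathcal P})$ is the universal unital $C^*$-algebra generated by elements $z_1,\dots,z_N$ subject to $\sum_i z_iz_i^*=1=\sum_i z_i^*z_i$ and $P=0$ for all $P\in\mathcal P$. Consider the following spaces of this form (all indices range over $\{1,\dots,N\}$): * $S^{N-1}_{\mathbb C,K}$, for an integer $K\ge 1$: the additional relations are $[z_{i_1}\cdots z_{i_K},\,z_{j_1}\cdots z_{j_K}]=0=[z_{i_1}\cdots z_{i_K},\,z_{j_1}^*\cdots z_{j_K}^*]$ for all $i_1,\dots,i_K,j_1,\dots,j_K$; * $S^{N-1}_{\mathbb C,\infty}$: the additional relations say that all the elements $z_i^*z_j$ and $z_jz_i^*$, for all $i,j$, commute with each other; * $S^{N-1}_{\mathbb C,*}$: the additional relations are $z_iz_j^*z_k=z_kz_j^*z_i$ for all $i,j,k$. For two such spaces, $Y\subset X$ means that there is a surjective morphism of unital $C^*$-algebras $C(X)\to C(Y)$ sending $z_i$ to $z_i$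 for every $i$ (it is then unique), and the inclusion is called strict when this morphism is not injective. **Proposition.** For every integer $K\ge 1$ there are strict inclusions $$S^{N-1}_{\mathbb C,K}\subset S^{N-1}_{\mathbb C,\infty}\subset S^{N-1}_{\mathbb C,*}.$$ -/

import Mathlib

open scoped ENNReal

namespace NCSphere

/-- Noncommutative polynomials in `z_1, …, z_N, z_1^*, …, z_N^*` with complex coefficients. -/
abbrev NCPoly (N : ℕ) : Type := FreeAlgebra ℂ (Fin N ⊕ Fin N)

/-- The indeterminate `z_i`. -/
noncomputable def Z {N : ℕ} (i : Fin N) : NCPoly N := FreeAlgebra.ι ℂ (Sum.inl i)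

/-- The indeterminate `z_i^*`. -/
noncomputable def Zs {N : ℕ} (i : Fin N) : NCPoly N := FreeAlgebra.ι ℂ (Sum.inr i)

/-- Evaluation of a noncommutative polynomial at a tuple `a`: `z_i ↦ a i`, `z_i^* ↦ star (a i)`. -/
noncomputable def evalAt {N : ℕ} {A : Type*} [Ring A] [Algebra ℂ A] [Star A] (a : Fin N → A) :
    NCPoly N →ₐ[ℂ] A :=
  FreeAlgebra.lift ℂ (Sum.elim a fun i => star (a i))

/-- The equations `∑ z_i z_i^* = 1 = ∑ z_i^* z_i` of the free complex sphere. -/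
def freeSphereRel (N : ℕ) : Set (NCPoly N) :=
  {∑ i, Z i * Zs i - 1, ∑ i, Zs i * Z i - 1}

/-- An algebraic submanifold of the free complex sphere, given by the family of noncommutative
polynomials `P` whose vanishing is imposed in addition to the equations of the free sphere. -/
structure AlgSubmanifold (N : ℕ) where
  rel : Set (NCPoly N)

/-- A tuple in a unital C⋆-algebra satisfies the equations of `X`, including the equations of
the free sphere. -/
def Satisfies {N : ℕ} (X : AlgSubmanifold N) {A : Type*} [CStarAlgebra A] (a : Fin N → A) : Prop :=
  ∀ P ∈ freeSphereRel N ∪ X.rel, evalAt a P = 0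

/-- A realization of the equations of `X`: a nonzero unital C⋆-algebra with a tuple satisfying
the equations. (The zero algebra would contribute nothing to the construction below.) -/
structure Realization {N : ℕ} (X : AlgSubmanifold N) where
  A : Type
  [cstar : CStarAlgebra A]
  [nontriv : Nontrivial A]
  pt : Fin N → A
  sat : Satisfies X pt

attribute [instance] Realization.cstar Realization.nontriv

/-- The C⋆-algebra `ℓ^∞`-product of all realizations of `X`. -/
abbrev BigProd {N : ℕ} (X : AlgSubmanifold N) : Type 1 := lp (fun r : Realization X => r.A) ∞

noncomputable instance instCStarAlgebraBigProd {N : ℕ} (X : AlgSubmanifold N) :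
    CStarAlgebra (BigProd X) where

theorem norm_le_one_of_satisfies {N : ℕ} {X : AlgSubmanifold N} {A : Type*} [CStarAlgebra A]
    {a : Fin N → A} (h : Satisfies X a) (i : Fin N) : ‖a i‖ ≤ 1 := by
  let := CStarAlgebra.spectralOrder A
  let := CStarAlgebra.spectralOrderedRing A
  have h1 : ∑ j, star (a j) * a j = 1 := by
    have := h (∑ i, Zs i * Z i - 1) (by simp [freeSphereRel])
    simpa [evalAt, Z, Zs, sub_eq_zero] using this
  have h2 : star (a i) * a i ≤ 1 := by
    rw [← h1]
    exact Finset.single_le_sum (f := fun j => star (a j) * a j)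
      (fun j _ => star_mul_self_nonneg (a j)) (Finset.mem_univ i)
  have h3 : ‖star (a i) * a i‖ ≤ 1 :=
    (CStarAlgebra.norm_le_one_iff_of_nonneg _ (star_mul_self_nonneg _)).2 h2
  rw [CStarRing.norm_star_mul_self] at h3
  nlinarith [norm_nonneg (a i)]

/-- The tuple of all realizations, bounded because `‖z_i‖ ≤ 1` in each of them. -/
noncomputable def bigPt {N : ℕ} (X : AlgSubmanifold N) (i : Fin N) : BigProd X :=
  ⟨fun r => r.pt i, memℓp_infty ⟨1, by
    rintro _ ⟨r, rfl⟩
    exact norm_le_one_of_satisfies r.sat i⟩⟩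

/-- The closed star-subalgebra generated by the canonical tuple in the product of all
realizations of `X`. -/
noncomputable def gen {N : ℕ} (X : AlgSubmanifold N) : StarSubalgebra ℂ (BigProd X) :=
  (StarAlgebra.adjoin ℂ (Set.range (bigPt X))).topologicalClosure

theorem isClosed_gen {N : ℕ} (X : AlgSubmanifold N) : IsClosed (gen X : Set (BigProd X)) :=
  StarSubalgebra.isClosed_topologicalClosure _

/-- The algebra `C(X) = C^*(z_1, …, z_N | equations of X)`: the universal C⋆-algebra generated by
a tuple satisfying the equations of `X`, built in the usual way, as the C⋆-subalgebra generated by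
the canonical tuple in the product of all realizations. The norm of a polynomial in the
coordinates is thus its largest norm over all realizations. Realizations in `Type` suffice, since
a finitely generated C⋆-algebra has at most continuum many elements; the universal property, with
respect to C⋆-algebras in every universe, is `existsUnique_hom` below. -/
def C {N : ℕ} (X : AlgSubmanifold N) : Type 1 := gen X

noncomputable instance instCStarAlgebraC {N : ℕ} (X : AlgSubmanifold N) : CStarAlgebra (C X) :=
  haveI := isClosed_gen X
  StarSubalgebra.cstarAlgebra (gen X)

/-- The standard coordinates `z_i ∈ C(X)`. -/
noncomputable def coord {N : ℕ} (X : AlgSubmanifold N) (i : Fin N) : C X :=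
  ⟨bigPt X i, StarSubalgebra.le_topologicalClosure _
    (StarAlgebra.subset_adjoin ℂ _ (Set.mem_range_self i))⟩

/-- The projection of the product to the algebra of a realization. -/
def proj {N : ℕ} {X : AlgSubmanifold N} (r : Realization X) : BigProd X →⋆ₐ[ℂ] r.A where
  toFun f := f r
  map_one' := rfl
  map_mul' _ _ := rfl
  map_zero' := rfl
  map_add' _ _ := rfl
  commutes' _ := rfl
  map_star' _ := rfl

/-- The embedding of `C(X)` in the product of all realizations. -/
noncomputable def incl {N : ℕ} (X : AlgSubmanifold N) : C X →⋆ₐ[ℂ] BigProd X where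
  toFun f := f.1
  map_one' := rfl
  map_mul' _ _ := rfl
  map_zero' := rfl
  map_add' _ _ := rfl
  commutes' _ := rfl
  map_star' _ := rfl

theorem map_evalAt {N : ℕ} {A B : Type*} [Ring A] [Algebra ℂ A] [Star A] [Ring B] [Algebra ℂ B]
    [Star B] (f : A →⋆ₐ[ℂ] B) (a : Fin N → A) (P : NCPoly N) :
    f (evalAt a P) = evalAt (fun i => f (a i)) P := by
  have : (f : A →ₐ[ℂ] B).comp (evalAt a) = evalAt (fun i => f (a i)) := by
    ext x
    rcases x with i | i <;> simp [evalAt, map_star]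
  exact DFunLike.congr_fun this P

/-- The coordinates of `X` satisfy the equations of `X`. -/
theorem satisfies_coord {N : ℕ} (X : AlgSubmanifold N) : Satisfies X (coord X) := by
  intro P hP
  apply Subtype.ext
  have h1 := map_evalAt (incl X) (coord X) P
  refine h1.trans ?_
  ext r
  have h2 := map_evalAt (proj r) (fun i => bigPt X i) P
  exact h2.trans (r.sat P hP)

theorem exists_model {B : Type*} [CStarAlgebra B] [Small.{0} B] :
    ∃ (B' : Type) (_ : CStarAlgebra B'), Nonempty (B' ≃⋆ₐ[ℂ] B) := by
  let e : Shrink.{0} B ≃ B := (equivShrink B).symm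
  let i1 : NormedRing (Shrink.{0} B) := e.normedRing
  let i2 : StarRing (Shrink.{0} B) := { e.starMul with
      star_add := fun x y => e.injective (by
        change e (e.symm (star (e (e.symm (e x + e y))))) = e (e.symm (e (e.symm (star (e x))) + e (e.symm (star (e y)))))
        simp only [Equiv.apply_symm_apply, star_add]) }
  let i3 : Algebra ℂ (Shrink.{0} B) := e.algebra ℂ
  have hn : ∀ x : Shrink.{0} B, ‖x‖ = ‖e x‖ := fun x => rfl
  have hmul : ∀ x y, e (x * y) = e x * e y := fun x y => e.apply_symm_apply _
  have hst : ∀ x, e (star x) = star (e x) := fun x => e.apply_symm_apply _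
  have hsm : ∀ (c : ℂ) x, e (c • x) = c • e x := fun c x => e.apply_symm_apply _
  have hadd : ∀ x y, e (x + y) = e x + e y := fun x y => e.apply_symm_apply _
  let i4 : NormedAlgebra ℂ (Shrink.{0} B) :=
    { i3 with norm_smul_le := fun c x => by rw [hn, hn, hsm]; exact norm_smul_le _ _ }
  have i5 : CStarRing (Shrink.{0} B) := ⟨fun x => by
    rw [hn, hn, hmul, hst]; exact CStarRing.norm_mul_self_le _⟩
  have i6 : StarModule ℂ (Shrink.{0} B) := ⟨fun c x => e.injective (by
    rw [hst, hsm, hsm, hst, star_smul])⟩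
  have hiso : Isometry e := fun x y => rfl
  have i7 : CompleteSpace (Shrink.{0} B) :=
    (completeSpace_congr (e := e) hiso.isUniformEmbedding).2 inferInstance
  refine ⟨Shrink.{0} B, { i1, i2, i4, i5, i6, i7 with }, ⟨?_⟩⟩
  exact { e with map_mul' := hmul, map_add' := hadd, map_star' := hst, map_smul' := hsm }

theorem small_gen {N : ℕ} {A : Type*} [CStarAlgebra A] (a : Fin N → A) :
    Small.{0} (StarAlgebra.adjoin ℂ (Set.range a)).topologicalClosure := by
  have hsub : ((StarAlgebra.adjoin ℂ (Set.range a)).topologicalClosure : Set A) ⊆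
      closure (Set.range (evalAt a)) := by
    rw [StarSubalgebra.topologicalClosure_coe]
    apply closure_mono
    have : (StarAlgebra.adjoin ℂ (Set.range a)).toSubalgebra ≤ (evalAt a).range := by
      rw [StarAlgebra.adjoin_toSubalgebra, Algebra.adjoin_le_iff]
      rintro x (⟨i, rfl⟩ | h)
      · exact ⟨Z i, by simp [evalAt, Z]⟩
      · obtain ⟨i, hi⟩ := h
        exact ⟨Zs i, by simp [evalAt, Zs, hi]⟩
    exact this
  have : Small.{0} (closure (Set.range (evalAt a))) := by
    have h : ∀ x : closure (Set.range (evalAt a)), ∃ u : ℕ → NCPoly N,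
        Filter.Tendsto (fun n => evalAt a (u n)) Filter.atTop (nhds (x : A)) := by
      rintro ⟨x, hx⟩
      obtain ⟨u, hu, hl⟩ := mem_closure_iff_seq_limit.1 hx
      choose v hv using hu
      exact ⟨v, by simpa [hv] using hl⟩
    choose u hu using h
    refine small_of_injective (f := u) ?_
    intro x y hxy
    have := hu x
    rw [hxy] at this
    exact Subtype.ext (tendsto_nhds_unique this (hu y))
  exact small_subset hsub

/-- Morphisms of C⋆-algebras are continuous. -/
theorem continuous_hom {A B : Type*} [CStarAlgebra A] [CStarAlgebra B] (f : A →⋆ₐ[ℂ] B) :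
    Continuous f :=
  AddMonoidHomClass.continuous_of_bound f 1
    (by simpa using NonUnitalStarAlgHom.norm_apply_le f)

/-- The universal property of `C(X)`: the tuples satisfying the equations of `X`, in a
C⋆-algebra of any universe, correspond to the morphisms out of `C(X)`. -/
theorem existsUnique_hom {N : ℕ} (X : AlgSubmanifold N) {A : Type*} [CStarAlgebra A] (a : Fin N → A)
    (h : Satisfies X a) : ∃! φ : C X →⋆ₐ[ℂ] A, ∀ i, φ (coord X i) = a i := by
  have hex : ∃ φ : C X →⋆ₐ[ℂ] A, ∀ i, φ (coord X i) = a i := by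
    rcases subsingleton_or_nontrivial A with hA | hA
    · exact ⟨{ toFun := fun _ => 0, map_one' := Subsingleton.elim _ _,
               map_mul' := fun _ _ => Subsingleton.elim _ _, map_zero' := rfl,
               map_add' := fun _ _ => Subsingleton.elim _ _,
               commutes' := fun _ => Subsingleton.elim _ _,
               map_star' := fun _ => Subsingleton.elim _ _ }, fun _ => Subsingleton.elim _ _⟩
    let S := (StarAlgebra.adjoin ℂ (Set.range a)).topologicalClosure
    have hcl : IsClosed (S : Set A) := StarSubalgebra.isClosed_topologicalClosure _
    let iS : CStarAlgebra S := StarSubalgebra.cstarAlgebra S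
    have := small_gen a
    obtain ⟨B', iB, ⟨e⟩⟩ := exists_model (B := S)
    have : Nontrivial B' := e.toEquiv.nontrivial
    let b : Fin N → S := fun i => ⟨a i, StarSubalgebra.le_topologicalClosure _
      (StarAlgebra.subset_adjoin ℂ _ (Set.mem_range_self i))⟩
    have hb : Satisfies X (fun i => (e.symm : S →⋆ₐ[ℂ] B') (b i)) := by
      intro P hP
      rw [← map_evalAt]
      have : evalAt b P = 0 := by
        apply Subtype.ext
        exact (map_evalAt S.subtype b P).trans (h P hP)
      rw [this, map_zero]
    let r : Realization X := { A := B', pt := _, sat := hb }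
    let pr : BigProd X →⋆ₐ[ℂ] B' := proj r
    refine ⟨S.subtype.comp ((e : B' →⋆ₐ[ℂ] S).comp (pr.comp (incl X))), ?_⟩
    intro i
    have : pr (bigPt X i) = e.symm (b i) := rfl
    change ((e (pr (bigPt X i)) : S) : A) = a i
    rw [this, e.apply_symm_apply]
  obtain ⟨φ, hφ⟩ := hex
  refine ⟨φ, hφ, fun ψ hψ => ?_⟩
  have hcψ : Continuous ψ := continuous_hom ψ
  have hcφ : Continuous φ := continuous_hom φ
  have key : ∀ (x : BigProd X) (hx : x ∈ StarAlgebra.adjoin ℂ (Set.range (bigPt X))),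
      ψ ⟨x, StarSubalgebra.le_topologicalClosure _ hx⟩ =
        φ ⟨x, StarSubalgebra.le_topologicalClosure _ hx⟩ := by
    intro x hx
    induction hx using StarAlgebra.adjoin_induction with
    | mem x h =>
      obtain ⟨i, rfl⟩ := h
      exact (hψ i).trans (hφ i).symm
    | algebraMap r => exact (AlgHomClass.commutes ψ r).trans (AlgHomClass.commutes φ r).symm
    | add x y hx hy h1 h2 =>
      exact (map_add ψ _ _).trans ((congrArg₂ _ h1 h2).trans (map_add φ _ _).symm)
    | mul x y hx hy h1 h2 =>
      exact (map_mul ψ _ _).trans ((congrArg₂ _ h1 h2).trans (map_mul φ _ _).symm)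
    | star x hx h1 =>
      exact (map_star ψ _).trans ((congrArg _ h1).trans (map_star φ _).symm)
  refine DFunLike.ext'_iff.2 (Continuous.ext_on (s := {x : C X | x.1 ∈
    StarAlgebra.adjoin ℂ (Set.range (bigPt X))}) ?_ hcψ hcφ fun x hx => key x.1 hx)
  intro x
  obtain ⟨u, hu, hl⟩ := mem_closure_iff_seq_limit.1 (show x.1 ∈ closure
    (StarAlgebra.adjoin ℂ (Set.range (bigPt X)) : Set (BigProd X)) from x.2)
  exact mem_closure_iff_seq_limit.2
    ⟨fun n => ⟨u n, StarSubalgebra.le_topologicalClosure _ (hu n)⟩, hu,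
      tendsto_subtype_rng.2 hl⟩

/-- The strict inclusion `Y ⊂ X` of noncommutative spaces: the canonical morphism
`C(X) → C(Y)`, `z_i ↦ z_i`, exists, is surjective (inclusion), and is not injective
(strictness). -/
def StrictInclusion {N : ℕ} (Y X : AlgSubmanifold N) : Prop :=
  ∃ φ : C X →⋆ₐ[ℂ] C Y, (∀ i, φ (coord X i) = coord Y i) ∧
    Function.Surjective φ ∧ ¬ Function.Injective φ

/-- The `K`-half-liberated complex sphere: the relations
`[z_{i_1} ⋯ z_{i_K}, z_{j_1} ⋯ z_{j_K}] = 0 = [z_{i_1} ⋯ z_{i_K}, z_{j_1}^* ⋯ z_{j_K}^*]`. -/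
def sphereK (N K : ℕ) : AlgSubmanifold N where
  rel := {P | ∃ i j : Fin K → Fin N,
    P = ⁅(List.ofFn fun s => Z (i s)).prod, (List.ofFn fun s => Z (j s)).prod⁆ ∨
    P = ⁅(List.ofFn fun s => Z (i s)).prod, (List.ofFn fun s => Zs (j s)).prod⁆}

/-- The strong half-liberated complex sphere: all the elements `z_i^* z_j`, `z_j z_i^*` commute. -/
def sphereInfty (N : ℕ) : AlgSubmanifold N where
  rel := {P | ∃ a b : NCPoly N,
    (∃ i j, a = Zs i * Z j ∨ a = Z j * Zs i) ∧ (∃ i j, b = Zs i * Z j ∨ b = Z j * Zs i) ∧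
    P = ⁅a, b⁆}

/-- The full half-liberated complex sphere: `a b^* c = c b^* a` for `a, b, c ∈ {z_i}`. -/
def sphereStar (N : ℕ) : AlgSubmanifold N where
  rel := {P | ∃ i j k : Fin N, P = Z i * Zs j * Z k - Z k * Zs j * Z i}

end NCSphere

namespace NCSphere

/-! The inclusions follow by inserting the sphere equations, i.e. `1 = ∑ z_l^* z_l` or its analogue
for words of length `K - 1`, into the products to be compared (`Satisfies.sphereInfty_of_sphereK`,
`Satisfies.sphereStar_of_sphereInfty`). Surjectivity of the resulting morphisms rests on closedness
of ranges.

For strictness, one tuple satisfying the weaker relations but not the stronger ones suffices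
(`strictInclusion_of_satisfies`). Both tuples have the form `z_i = b_i w`, with `w` unitary and the
`b_i` commuting, self-adjoint, of square sum `1`. Then `z_i z_j^* z_k = b_i b_j b_k w`, `z_j z_i^* =
b_j b_i` and `z_i^* z_j = w^* b_i b_j w`. So the relations of `sphereStar` always hold, and those of
`sphereInfty` hold once the `b_i` commute with their conjugates by `w`. A rotation breaks this
commutation. A cyclic shift of order `K + 1` preserves it but breaks the relations of `sphereK`. -/

/-! ### Closed range of C⋆-morphisms -/

/-- Truncate `a` at level `‖f a‖` by functional calculus: `f` commutes with it, and the truncation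
is the identity on the spectrum of `f a`. -/
theorem exists_norm_le_of_isSelfAdjoint {A B : Type*} [CStarAlgebra A] [CStarAlgebra B]
    (f : A →⋆ₐ[ℂ] B) {a : A} (ha : IsSelfAdjoint a) : ∃ x, f x = f a ∧ ‖x‖ ≤ ‖f a‖ := by
  have hf : Continuous f := continuous_hom f
  have hfa : IsSelfAdjoint (f a) := ha.map f
  have hg : Continuous fun t : ℝ => max (-‖f a‖) (min ‖f a‖ t) := by fun_prop
  refine ⟨cfc (fun t : ℝ => max (-‖f a‖) (min ‖f a‖ t)) a, ?_, ?_⟩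
  · rw [StarAlgHom.map_cfc (R := ℝ) f _ a hg.continuousOn hf ha hfa]
    refine (cfc_congr (g := id) fun t ht => ?_).trans (cfc_id ℝ (f a))
    rcases subsingleton_or_nontrivial B with hB | hB
    · simp [spectrum.of_subsingleton] at ht
    have := abs_le.1 (spectrum.norm_le_norm_of_mem ht)
    simp [this.1, this.2]
  · refine norm_cfc_le (norm_nonneg _) fun t _ => abs_le.2 ⟨le_max_left _ _, ?_⟩
    exact max_le (by linarith [norm_nonneg (f a)]) (min_le_left _ _)

theorem exists_norm_le {A B : Type*} [CStarAlgebra A] [CStarAlgebra B]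
    (f : A →⋆ₐ[ℂ] B) (a : A) : ∃ x, f x = f a ∧ ‖x‖ ≤ 2 * ‖f a‖ := by
  obtain ⟨x, hx, hxn⟩ := exists_norm_le_of_isSelfAdjoint f (realPart a).2
  obtain ⟨y, hy, hyn⟩ := exists_norm_le_of_isSelfAdjoint f (imaginaryPart a).2
  have hre : f (realPart a : A) = (realPart (f a) : B) := by
    simp only [realPart_apply_coe, map_real_smul f (continuous_hom f), map_add, map_star]
  have him : f (imaginaryPart a : A) = (imaginaryPart (f a) : B) := by
    simp only [imaginaryPart_apply_coe, map_smul, map_real_smul f (continuous_hom f), map_sub,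
      map_star]
  refine ⟨x + Complex.I • y, ?_, ?_⟩
  · rw [map_add, map_smul, hx, hy, ← map_smul, ← map_add, realPart_add_I_smul_imaginaryPart]
  · rw [hre] at hxn
    rw [him] at hyn
    have h1 := realPart.norm_le (f a)
    have h2 := imaginaryPart.norm_le (f a)
    have h3 : ‖Complex.I • y‖ = ‖y‖ := by simp [norm_smul]
    have h4 := norm_add_le x (Complex.I • y)
    change ‖(realPart (f a) : B)‖ ≤ _ at h1
    change ‖(imaginaryPart (f a) : B)‖ ≤ _ at h2
    linarith

/-- Morphisms of C⋆-algebras have closed range. -/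
theorem isClosed_range {A B : Type*} [CStarAlgebra A] [CStarAlgebra B] (f : A →⋆ₐ[ℂ] B) :
    IsClosed (f.range : Set B) := by
  let g : NormedAddGroupHom A B :=
    { toFun := f, map_add' := map_add f
      bound' := ⟨1, fun x => by simpa using NonUnitalStarAlgHom.norm_apply_le f x⟩ }
  have hg : g.SurjectiveOnWith g.range 2 := by
    rintro _ ⟨a, rfl⟩
    exact exists_norm_le f a
  -- Norm-controlled lifting on the range extends to its closure because `A` is complete.
  have hcl := controlled_closure_of_complete two_pos one_pos hg
  refine isClosed_of_closure_subset fun y hy => ?_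
  obtain ⟨x, hx, -⟩ := hcl y (by
    rw [← SetLike.mem_coe, AddSubgroup.topologicalClosure_coe]
    convert! hy)
  exact ⟨x, hx⟩

/-! ### Surjectivity and strictness from the universal property -/

/-- The range, being closed, is itself a C⋆-algebra, so the universal property applies inside it. -/
theorem exists_hom_mem_range {N : ℕ} {X : AlgSubmanifold N} {A B : Type*} [CStarAlgebra A]
    [CStarAlgebra B] (f : A →⋆ₐ[ℂ] B) {b : Fin N → B} (hb : Satisfies X b)
    (h : ∀ i, b i ∈ f.range) :
    ∃ ψ : C X →⋆ₐ[ℂ] B, (∀ i, ψ (coord X i) = b i) ∧ ∀ y, ψ y ∈ f.range := by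
  have := isClosed_range f
  let iS : CStarAlgebra f.range := StarSubalgebra.cstarAlgebra f.range
  let c : Fin N → f.range := fun i => ⟨b i, h i⟩
  have hc : Satisfies X c := fun P hP =>
    Subtype.ext ((map_evalAt f.range.subtype c P).trans (hb P hP))
  obtain ⟨ψ, hψ, -⟩ := existsUnique_hom X c hc
  exact ⟨f.range.subtype.comp ψ, fun i => congrArg Subtype.val (hψ i), fun y => (ψ y).2⟩

/-- A morphism to `C(X)` is surjective as soon as its range contains the coordinates. -/
theorem surjective_of_coord {N : ℕ} {X : AlgSubmanifold N} {A : Type*} [CStarAlgebra A]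
    (f : A →⋆ₐ[ℂ] C X) (h : ∀ i, coord X i ∈ f.range) : Function.Surjective f := by
  obtain ⟨ψ, hψ, hmem⟩ := exists_hom_mem_range f (satisfies_coord X) h
  -- By uniqueness, the morphism that factors through the range of `f` is the identity.
  have hid : ψ = StarAlgHom.id ℂ (C X) :=
    (existsUnique_hom X _ (satisfies_coord X)).unique hψ fun i => rfl
  intro y
  have hy := hmem y
  rw [hid] at hy
  exact hy

/-- Injectivity would carry the relations of `Y` back to the coordinates of `X`, hence to every
tuple satisfying the equations of `X`, including `a`. -/
theorem strictInclusion_of_satisfies {N : ℕ} {Y X : AlgSubmanifold N}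
    (h : Satisfies X (coord Y)) {A : Type*} [CStarAlgebra A] {a : Fin N → A}
    (ha : Satisfies X a) (ha' : ¬ Satisfies Y a) : StrictInclusion Y X := by
  obtain ⟨φ, hφ, -⟩ := existsUnique_hom X _ h
  refine ⟨φ, hφ, surjective_of_coord φ fun i => ⟨coord X i, hφ i⟩, fun hinj => ha' fun P hP => ?_⟩
  have h1 : evalAt (coord X) P = 0 := hinj <| by
    rw [map_evalAt, map_zero]
    simpa only [hφ] using satisfies_coord Y P hP
  obtain ⟨ψ, hψ, -⟩ := existsUnique_hom X a ha
  have h2 := map_evalAt ψ (coord X) P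
  rw [h1, map_zero] at h2
  simpa only [hψ] using h2.symm

/-! ### The relations in concrete form, and the inclusions -/

section Relations

variable {N : ℕ} {A : Type*} [CStarAlgebra A] {a : Fin N → A}

@[simp] theorem evalAt_Z (i : Fin N) : evalAt a (Z i) = a i := by simp [evalAt, Z]

@[simp] theorem evalAt_Zs (i : Fin N) : evalAt a (Zs i) = star (a i) := by simp [evalAt, Zs]

theorem evalAt_lie (P Q : NCPoly N) : evalAt a ⁅P, Q⁆ = ⁅evalAt a P, evalAt a Q⁆ := by
  simp [Ring.lie_def]

theorem satisfies_iff (X : AlgSubmanifold N) : Satisfies X a ↔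
    (∑ i, a i * star (a i) = 1 ∧ ∑ i, star (a i) * a i = 1) ∧ ∀ P ∈ X.rel, evalAt a P = 0 := by
  simp [Satisfies, freeSphereRel, or_imp, forall_and, sub_eq_zero]

theorem satisfies_sphereStar_iff : Satisfies (sphereStar N) a ↔
    (∑ i, a i * star (a i) = 1 ∧ ∑ i, star (a i) * a i = 1) ∧
      ∀ i j k, a i * star (a j) * a k = a k * star (a j) * a i := by
  rw [satisfies_iff, and_congr_right_iff]
  refine fun _ => ⟨fun h i j k => ?_, ?_⟩
  · simpa [sub_eq_zero] using h _ ⟨i, j, k, rfl⟩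
  · rintro h _ ⟨i, j, k, rfl⟩
    simpa [sub_eq_zero] using h i j k

theorem satisfies_sphereInfty_iff : Satisfies (sphereInfty N) a ↔
    (∑ i, a i * star (a i) = 1 ∧ ∑ i, star (a i) * a i = 1) ∧
      ∀ x y, (∃ i j, x = star (a i) * a j ∨ x = a j * star (a i)) →
        (∃ i j, y = star (a i) * a j ∨ y = a j * star (a i)) → Commute x y := by
  rw [satisfies_iff, and_congr_right_iff]
  refine fun _ => ⟨fun h => ?_, ?_⟩
  · have key (P : A) (hP : ∃ i j, P = star (a i) * a j ∨ P = a j * star (a i)) :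
        ∃ Q : NCPoly N, (∃ i j, Q = Zs i * Z j ∨ Q = Z j * Zs i) ∧ evalAt a Q = P := by
      obtain ⟨i, j, rfl | rfl⟩ := hP
      · exact ⟨_, ⟨i, j, .inl rfl⟩, by simp⟩
      · exact ⟨_, ⟨i, j, .inr rfl⟩, by simp⟩
    intro x y hx hy
    obtain ⟨P, hP, rfl⟩ := key x hx
    obtain ⟨Q, hQ, rfl⟩ := key y hy
    rw [commute_iff_lie_eq, ← evalAt_lie]
    exact h _ ⟨P, Q, hP, hQ, rfl⟩
  · rintro h _ ⟨P, Q, ⟨i, j, hP⟩, ⟨k, l, hQ⟩, rfl⟩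
    rw [evalAt_lie, ← commute_iff_lie_eq]
    refine h _ _ ⟨i, j, ?_⟩ ⟨k, l, ?_⟩
    · rcases hP with rfl | rfl <;> simp
    · rcases hQ with rfl | rfl <;> simp

theorem satisfies_sphereK_iff {K : ℕ} : Satisfies (sphereK N K) a ↔
    (∑ i, a i * star (a i) = 1 ∧ ∑ i, star (a i) * a i = 1) ∧
      ∀ i j : Fin K → Fin N,
        Commute (List.ofFn fun s => a (i s)).prod (List.ofFn fun s => a (j s)).prod ∧
        Commute (List.ofFn fun s => a (i s)).prod (List.ofFn fun s => star (a (j s))).prod := by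
  have hZ (i : Fin K → Fin N) : evalAt a (List.ofFn fun s => Z (i s)).prod =
      (List.ofFn fun s => a (i s)).prod := by
    simp [map_list_prod, List.map_ofFn, Function.comp_def]
  have hZs (i : Fin K → Fin N) : evalAt a (List.ofFn fun s => Zs (i s)).prod =
      (List.ofFn fun s => star (a (i s))).prod := by
    simp [map_list_prod, List.map_ofFn, Function.comp_def]
  rw [satisfies_iff, and_congr_right_iff]
  refine fun _ => ⟨fun h i j => ⟨?_, ?_⟩, ?_⟩
  · rw [commute_iff_lie_eq, ← hZ, ← hZ, ← evalAt_lie]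
    exact h _ ⟨i, j, .inl rfl⟩
  · rw [commute_iff_lie_eq, ← hZ, ← hZs, ← evalAt_lie]
    exact h _ ⟨i, j, .inr rfl⟩
  · rintro h _ ⟨i, j, rfl | rfl⟩
    · rw [evalAt_lie, hZ, hZ, ← commute_iff_lie_eq]
      exact (h i j).1
    · rw [evalAt_lie, hZ, hZs, ← commute_iff_lie_eq]
      exact (h i j).2

theorem Satisfies.sphereStar_of_sphereInfty (h : Satisfies (sphereInfty N) a) :
    Satisfies (sphereStar N) a := by
  rw [satisfies_sphereInfty_iff] at h
  obtain ⟨⟨h1, h2⟩, h⟩ := h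
  refine satisfies_sphereStar_iff.2 ⟨⟨h1, h2⟩, fun i j k => ?_⟩
  calc a i * star (a j) * a k = ∑ l, a i * star (a j) * a k * (star (a l) * a l) := by
        rw [← Finset.mul_sum, h2, mul_one]
    _ = ∑ l, a k * star (a j) * (a l * star (a l)) * a i := by
        refine Finset.sum_congr rfl fun l _ => ?_
        have e1 := (h (a i * star (a j)) (a k * star (a l)) ⟨j, i, .inr rfl⟩ ⟨l, k, .inr rfl⟩).eq
        have e2 := (h (star (a l) * a i) (star (a j) * a l) ⟨l, i, .inl rfl⟩ ⟨j, l, .inl rfl⟩).eq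
        calc a i * star (a j) * a k * (star (a l) * a l)
            = a i * star (a j) * (a k * star (a l)) * a l := by simp only [mul_assoc]
          _ = a k * (star (a l) * a i * (star (a j) * a l)) := by rw [e1]; simp only [mul_assoc]
          _ = _ := by rw [e2]; simp only [mul_assoc]
    _ = a k * star (a j) * a i := by rw [← Finset.sum_mul, ← Finset.mul_sum, h1, mul_one]

theorem sum_fin_succ_arrow {n : ℕ} (f : (Fin (n + 1) → Fin N) → A) :
    ∑ I, f I = ∑ i : Fin N, ∑ I : Fin n → Fin N, f (Fin.cons i I) := by
  rw [← (Fin.consEquiv fun _ : Fin (n + 1) => Fin N).sum_comp f, Fintype.sum_prod_type]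
  rfl

theorem prod_ofFn_cons {n : ℕ} (b : Fin N → A) (i : Fin N) (I : Fin n → Fin N) :
    (List.ofFn fun s => b ((Fin.cons i I : Fin (n + 1) → Fin N) s)).prod =
      b i * (List.ofFn fun s => b (I s)).prod := by
  simp [List.ofFn_succ]

theorem prod_ofFn_snoc {n : ℕ} (b : Fin N → A) (I : Fin n → Fin N) (i : Fin N) :
    (List.ofFn fun s => b ((Fin.snoc I i : Fin (n + 1) → Fin N) s)).prod =
      (List.ofFn fun s => b (I s)).prod * b i := by
  rw [List.ofFn_succ']
  simp

theorem star_prod_ofFn {n : ℕ} (I : Fin n → Fin N) :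
    star (List.ofFn fun s => a (I s)).prod =
      (List.ofFn fun s => star (a (I (Fin.rev s)))).prod := by
  induction n with
  | zero => simp
  | succ n ih =>
    rw [List.ofFn_succ, List.prod_cons, star_mul, ih fun s => I s.succ, List.ofFn_succ']
    simp [Fin.rev_castSucc]

theorem sum_star_prod_mul_prod (h : ∑ i, star (a i) * a i = 1) (n : ℕ) :
    ∑ I : Fin n → Fin N,
      star (List.ofFn fun s => a (I s)).prod * (List.ofFn fun s => a (I s)).prod = 1 := by
  induction n with
  | zero => simp
  | succ n ih =>
    -- The first letter sits in the middle of `star word * word`, so it is summed innermost.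
    rw [sum_fin_succ_arrow, Finset.sum_comm, ← ih]
    refine Finset.sum_congr rfl fun I _ => ?_
    simp only [prod_ofFn_cons, star_mul]
    generalize (List.ofFn fun s => a (I s)).prod = w
    calc ∑ i, star w * star (a i) * (a i * w) = star w * (∑ i, star (a i) * a i) * w := by
          simp only [Finset.mul_sum, Finset.sum_mul, mul_assoc]
      _ = star w * w := by rw [h, mul_one]

theorem sum_prod_mul_star_prod (h : ∑ i, a i * star (a i) = 1) (n : ℕ) :
    ∑ I : Fin n → Fin N,
      (List.ofFn fun s => a (I s)).prod * star (List.ofFn fun s => a (I s)).prod = 1 := by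
  induction n with
  | zero => simp
  | succ n ih =>
    rw [sum_fin_succ_arrow, ← h]
    refine Finset.sum_congr rfl fun i _ => ?_
    simp only [prod_ofFn_cons, star_mul]
    calc _ = a i * (∑ I : Fin n → Fin N,
          (List.ofFn fun s => a (I s)).prod * star (List.ofFn fun s => a (I s)).prod) *
            star (a i) := by
          simp only [Finset.mul_sum, Finset.sum_mul, mul_assoc]
      _ = a i * star (a i) := by rw [ih, mul_one]

/-- Padding with words of length `K - 1` writes each `z_i^* z_j` and `z_j z_i^*` as a sum of
products of a word of length `K` and an adjoint of one, all of which commute. -/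
theorem Satisfies.sphereInfty_of_sphereK {K : ℕ} (hK : 1 ≤ K) (h : Satisfies (sphereK N K) a) :
    Satisfies (sphereInfty N) a := by
  obtain ⟨n, rfl⟩ := Nat.exists_eq_add_of_le' hK
  rw [satisfies_sphereK_iff] at h
  obtain ⟨⟨h1, h2⟩, h⟩ := h
  let w (I : Fin (n + 1) → Fin N) : A := (List.ofFn fun s => a (I s)).prod
  let v (I : Fin n → Fin N) : A := (List.ofFn fun s => a (I s)).prod
  have hw (I J) : Commute (w I) (w J) := (h I J).1
  have hws (I J) : Commute (w I) (star (w J)) := by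
    simp only [w, star_prod_ofFn]
    -- The adjoint reverses the word; this is harmless since all multi-indices are allowed.
    exact (h I fun s => J s.rev).2
  have hsw (I J) : Commute (star (w I)) (w J) := (hws J I).symm
  have hss (I J) : Commute (star (w I)) (star (w J)) := (hw I J).star_star
  have e1 (i j : Fin N) :
      star (a i) * a j = ∑ I, star (w (Fin.snoc I i)) * w (Fin.snoc I j) := by
    calc _ = star (a i) * (∑ I, star (v I) * v I) * a j := by
          rw [sum_star_prod_mul_prod h2, mul_one]
      _ = _ := by
          simp only [w, v, prod_ofFn_snoc, star_mul, Finset.mul_sum, Finset.sum_mul, mul_assoc]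
  have e2 (i j : Fin N) :
      a j * star (a i) = ∑ I, w (Fin.cons j I) * star (w (Fin.cons i I)) := by
    calc _ = a j * (∑ I, v I * star (v I)) * star (a i) := by
          rw [sum_prod_mul_star_prod h1, mul_one]
      _ = _ := by
          simp only [w, v, prod_ofFn_cons, star_mul, Finset.mul_sum, Finset.sum_mul, mul_assoc]
  refine satisfies_sphereInfty_iff.2 ⟨⟨h1, h2⟩, ?_⟩
  rintro _ _ ⟨i, j, rfl | rfl⟩ ⟨k, l, rfl | rfl⟩ <;> simp only [e1, e2] <;>
    refine Commute.sum_left _ _ _ fun I _ => Commute.sum_right _ _ _ fun J _ => ?_ <;>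
    simp only [hw, hws, hsw, hss, Commute.mul_left, Commute.mul_right]

end Relations

/-! ### Tuples twisted by a unitary -/

section Twist

variable {N : ℕ} {A : Type*} [CStarAlgebra A] {b : Fin N → A} {w : A}

theorem sum_twist (hs : ∀ i, star (b i) = b i) (hb : ∑ i, b i * b i = 1)
    (hw : w * star w = 1) (hw' : star w * w = 1) :
    ∑ i, b i * w * star (b i * w) = 1 ∧ ∑ i, star (b i * w) * (b i * w) = 1 := by
  constructor
  · rw [← hb]
    refine Finset.sum_congr rfl fun i _ => ?_
    rw [star_mul, hs, mul_assoc, ← mul_assoc w, hw, one_mul]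
  · calc _ = star w * (∑ i, b i * b i) * w := by
          simp only [star_mul, hs, Finset.mul_sum, Finset.sum_mul, mul_assoc]
      _ = 1 := by rw [hb, mul_one, hw']

theorem satisfies_sphereStar_twist (hs : ∀ i, star (b i) = b i) (hb : ∑ i, b i * b i = 1)
    (hc : ∀ i j, Commute (b i) (b j)) (hw : w * star w = 1) (hw' : star w * w = 1) :
    Satisfies (sphereStar N) fun i => b i * w := by
  refine satisfies_sphereStar_iff.2 ⟨sum_twist hs hb hw hw', fun i j k => ?_⟩
  have key (i j k : Fin N) : b i * w * star (b j * w) * (b k * w) = b i * (b j * b k) * w := by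
    calc _ = b i * (w * star w) * star (b j) * b k * w := by simp only [star_mul, mul_assoc]
      _ = _ := by rw [hw, hs]; simp only [mul_one, mul_assoc]
  rw [key, key, ((hc k j).mul_right (hc k i)).eq, (hc j i).eq, ← mul_assoc (b i)]

theorem satisfies_sphereInfty_twist (hs : ∀ i, star (b i) = b i) (hb : ∑ i, b i * b i = 1)
    (hc : ∀ i j, Commute (b i) (b j)) (hw : w * star w = 1) (hw' : star w * w = 1)
    (hcw : ∀ i j, Commute (b i) (star w * b j * w)) :
    Satisfies (sphereInfty N) fun i => b i * w := by
  have conj_mul (x y : A) : star w * (x * y) * w = star w * x * w * (star w * y * w) := by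
    calc _ = star w * x * (1 * (y * w)) := by simp only [one_mul, mul_assoc]
      _ = _ := by rw [← hw]; simp only [mul_assoc]
  have hcc (i j) : Commute (star w * b i * w) (star w * b j * w) := by
    rw [commute_iff_eq, ← conj_mul, ← conj_mul, (hc i j).eq]
  have hwc (i j) : Commute (star w * b i * w) (b j) := (hcw j i).symm
  have e1 (i j : Fin N) :
      star (b i * w) * (b j * w) = star w * b i * w * (star w * b j * w) := by
    rw [← conj_mul, star_mul, hs]
    simp only [mul_assoc]
  have e2 (i j : Fin N) : b j * w * star (b i * w) = b j * b i := by
    rw [star_mul, hs, mul_assoc, ← mul_assoc w, hw, one_mul]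
  refine satisfies_sphereInfty_iff.2 ⟨sum_twist hs hb hw hw', ?_⟩
  rintro _ _ ⟨i, j, rfl | rfl⟩ ⟨k, l, rfl | rfl⟩ <;> simp only [e1, e2] <;>
    simp only [hc, hcw, hcc, hwc, Commute.mul_left, Commute.mul_right]

/-- The tuple `(3/5 s, 4/5, 0, …, 0)`. -/
noncomputable def pythag (N : ℕ) (s : A) (i : Fin N) : A :=
  if i.1 = 0 then (3 / 5 : ℝ) • s else if i.1 = 1 then (4 / 5 : ℝ) • 1 else 0

variable {s : A}

theorem star_pythag (hs : star s = s) (i : Fin N) : star (pythag N s i) = pythag N s i := by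
  unfold pythag
  split_ifs <;> simp [hs]

theorem commute_pythag {x : A} (h : Commute s x) (i : Fin N) : Commute (pythag N s i) x := by
  unfold pythag
  split_ifs
  · exact h.smul_left _
  · exact (Commute.one_left _).smul_left _
  · exact Commute.zero_left _

theorem sum_pythag (hN : 2 ≤ N) (hs : s * s = 1) : ∑ i, pythag N s i * pythag N s i = 1 := by
  obtain ⟨m, rfl⟩ := Nat.exists_eq_add_of_le' hN
  rw [Fin.sum_univ_succ, Fin.sum_univ_succ, Finset.sum_eq_zero]
  · simp [pythag, hs, smul_smul, ← add_smul]
    norm_num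
  · intro i _
    simp [pythag]

theorem commute_conj_pythag (hw' : star w * w = 1) {x : A} (h : Commute x (star w * s * w))
    (i : Fin N) : Commute x (star w * pythag N s i * w) := by
  unfold pythag
  split_ifs
  · simpa using h.smul_right (3 / 5 : ℝ)
  · simp [hw']
  · simp

theorem satisfies_sphereStar_pythag (hN : 2 ≤ N) (hs : star s = s) (hs2 : s * s = 1)
    (hw : w * star w = 1) (hw' : star w * w = 1) :
    Satisfies (sphereStar N) fun i => pythag N s i * w :=
  satisfies_sphereStar_twist (star_pythag hs) (sum_pythag hN hs2)
    (fun _ j => commute_pythag (commute_pythag (Commute.refl s) j).symm _) hw hw'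

theorem satisfies_sphereInfty_pythag (hN : 2 ≤ N) (hs : star s = s) (hs2 : s * s = 1)
    (hw : w * star w = 1) (hw' : star w * w = 1) (hsw : Commute s (star w * s * w)) :
    Satisfies (sphereInfty N) fun i => pythag N s i * w :=
  satisfies_sphereInfty_twist (star_pythag hs) (sum_pythag hN hs2)
    (fun _ j => commute_pythag (commute_pythag (Commute.refl s) j).symm _) hw hw'
    (fun _ j => commute_conj_pythag hw' (commute_pythag hsw _) j)

theorem commute_conj_of_satisfies (hN : 2 ≤ N) (hs : star s = s) (hw : w * star w = 1)
    (h : Satisfies (sphereInfty N) fun i => pythag N s i * w) : Commute s (star w * s * w) := by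
  obtain ⟨-, h⟩ := satisfies_sphereInfty_iff.1 h
  let i : Fin N := ⟨0, by omega⟩
  let j : Fin N := ⟨1, by omega⟩
  -- These two products are `12/25` times `s` and `12/25` times `star w * s * w`.
  have := h _ _ ⟨j, i, .inr rfl⟩ ⟨i, j, .inl rfl⟩
  simpa [pythag, i, j, hs, hw, mul_assoc, Commute.smul_left_iff₀,
    Commute.smul_right_iff₀] using this

theorem commute_pow_of_satisfies {K : ℕ} (hN : 2 ≤ N) (hK : 1 ≤ K)
    (h : Satisfies (sphereK N K) fun i => pythag N s i * w) :
    Commute (s * w ^ K) (w ^ K) := by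
  obtain ⟨-, h⟩ := satisfies_sphereK_iff.1 h
  obtain ⟨n, rfl⟩ := Nat.exists_eq_add_of_le' hK
  let i : Fin N := ⟨0, by omega⟩
  let j : Fin N := ⟨1, by omega⟩
  -- These words are nonzero multiples of `s * w ^ K` and `w ^ K`.
  have := (h (Fin.cons i fun _ => j) fun _ => j).1
  rw [prod_ofFn_cons (fun i => pythag N s i * w)] at this
  simpa [pythag, i, j, smul_pow, pow_succ', mul_assoc, Commute.smul_left_iff₀,
    Commute.smul_right_iff₀] using this

end Twist

/-! ### Matrix models and conclusion -/

-- Take the cyclic shift on `ZMod n` and a diagonal sign matrix: conjugating by the shift keeps it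
-- diagonal, but moves its only `-1`.
open Matrix in
theorem exists_shift (n : ℕ) [NeZero n] (hn : 1 < n) : ∃ s w : CStarMatrix (ZMod n) (ZMod n) ℂ,
    star s = s ∧ s * s = 1 ∧ w * star w = 1 ∧ star w * w = 1 ∧ w ^ n = 1 ∧
      Commute s (star w * s * w) ∧ ¬ Commute s w := by
  have : Fact (1 < n) := ⟨hn⟩
  let d (x : ZMod n) : ℂ := if x = 0 then -1 else 1
  let u (k : ZMod n) : Matrix (ZMod n) (ZMod n) ℂ :=
    of fun i j => if i = j + k then 1 else 0
  let e : Matrix (ZMod n) (ZMod n) ℂ ≃⋆ₐ[ℂ] CStarMatrix (ZMod n) (ZMod n) ℂ :=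
    CStarMatrix.ofMatrixStarAlgEquiv
  have hu0 : u 0 = 1 := by ext i j; simp [u, Matrix.one_apply]
  have humul (k l) : u k * u l = u (k + l) := by
    ext i j
    simp [u, Matrix.mul_apply, add_assoc, add_comm l k]
  have hustar (k) : star (u k) = u (-k) := by
    ext i j
    simp [u, Matrix.star_apply, apply_ite, eq_add_neg_iff_add_eq, eq_comm]
  have hupow (m : ℕ) : u 1 ^ m = u m := by
    induction m with
    | zero => simp [hu0]
    | succ m ih => rw [pow_succ, ih, humul, Nat.cast_succ]
  have hd (x) : d x * d x = 1 := by simp only [d]; split_ifs <;> simp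
  have hds (x) : star (d x) = d x := by simp only [d]; split_ifs <;> simp
  have hconj : star (u 1) * diagonal d * u 1 = diagonal fun x => d (x + 1) := by
    have h : diagonal d * u 1 = u 1 * diagonal fun x => d (x + 1) := by
      ext i j
      by_cases hij : i = j + 1 <;> simp [u, hij]
    rw [mul_assoc, h, ← mul_assoc, hustar, humul, neg_add_cancel, hu0, one_mul]
  have hcomm : Commute (diagonal d) (diagonal fun x => d (x + 1)) := by
    simp [commute_iff_eq, Matrix.diagonal_mul_diagonal, mul_comm]
  refine ⟨e (diagonal d), e (u 1), ?_, ?_, ?_, ?_, ?_, ?_, fun h => ?_⟩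
  · rw [← map_star, Matrix.star_eq_conjTranspose, Matrix.diagonal_conjTranspose]
    congr 2
    exact funext hds
  · rw [← map_mul, Matrix.diagonal_mul_diagonal, ← map_one e, ← Matrix.diagonal_one]
    congr 2
    exact funext hd
  · rw [← map_star, ← map_mul, hustar, humul, add_neg_cancel, hu0, map_one]
  · rw [← map_star, ← map_mul, hustar, humul, neg_add_cancel, hu0, map_one]
  · rw [← map_pow, hupow, ZMod.natCast_self, hu0, map_one]
  · rw [← map_star, ← map_mul, ← map_mul, hconj]
    exact hcomm.map e
  · have h1 : diagonal d * u 1 = u 1 * diagonal d := 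
      e.injective ((map_mul e _ _).trans (h.eq.trans (map_mul e _ _).symm))
    -- At this entry the two sides are `d 1 = 1` and `d 0 = -1`.
    have h2 := congrFun (congrFun h1 1) 0
    simp [u, d, Matrix.diagonal_mul, Matrix.mul_diagonal] at h2
    norm_num at h2

/-- Commuting with `diag(1, -1)` means being diagonal, and this rotation conjugates `s` to a
non-diagonal matrix. -/
theorem exists_rotation : ∃ s w : CStarMatrix (Fin 2) (Fin 2) ℂ,
    star s = s ∧ s * s = 1 ∧ w * star w = 1 ∧ star w * w = 1 ∧
      ¬ Commute s (star w * s * w) := by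
  let e : Matrix (Fin 2) (Fin 2) ℂ ≃⋆ₐ[ℂ] CStarMatrix (Fin 2) (Fin 2) ℂ :=
    CStarMatrix.ofMatrixStarAlgEquiv
  let s : Matrix (Fin 2) (Fin 2) ℂ := !![1, 0; 0, -1]
  let w : Matrix (Fin 2) (Fin 2) ℂ := !![3 / 5, 4 / 5; -4 / 5, 3 / 5]
  have hs : star s = s := by ext i j; fin_cases i <;> fin_cases j <;> simp [s]
  have hw : star w = !![3 / 5, -4 / 5; 4 / 5, 3 / 5] := by
    ext i j; fin_cases i <;> fin_cases j <;> simp [w]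
  refine ⟨e s, e w, ?_, ?_, ?_, ?_, fun h => ?_⟩
  · rw [← map_star, hs]
  · rw [← map_mul, ← map_one e]
    congr 1
    simp [s, Matrix.one_fin_two]
  · rw [← map_star, ← map_mul, ← map_one e, hw]
    congr 1
    simp [w, Matrix.one_fin_two]
    norm_num
  · rw [← map_star, ← map_mul, ← map_one e, hw]
    congr 1
    simp [w, Matrix.one_fin_two]
    norm_num
  · rw [← map_star, hw, ← map_mul, ← map_mul] at h
    have h1 := e.injective ((map_mul e _ _).trans (h.eq.trans (map_mul e _ _).symm))
    have h2 := congrFun (congrFun h1 0) 1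
    simp [s, w] at h2
    norm_num at h2

/-- Here `w ^ K = star w`, and one factor `star w` cancels. -/
theorem commute_of_commute_mul_pow {A : Type*} [CStarAlgebra A] {s w : A} {K : ℕ}
    (hw : w * star w = 1) (hw' : star w * w = 1) (hp : w ^ (K + 1) = 1)
    (h : Commute (s * w ^ K) (w ^ K)) : Commute s w := by
  have hK : w ^ K = star w := by
    rw [← mul_one (w ^ K), ← hw, ← mul_assoc, ← pow_succ, hp, one_mul]
  rw [hK] at h
  have h1 : s * star w = star w * s := by
    have := congrArg (· * w) h.eq
    simpa only [mul_assoc, hw', mul_one] using this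
  calc s * w = w * (star w * s) * w := by rw [← mul_assoc w, hw, one_mul]
    _ = w * s := by rw [← h1]; simp only [mul_assoc, hw', mul_one]

open scoped ComplexOrder in
theorem strictInclusion_sphereK_sphereInfty {N K : ℕ} (hN : 2 ≤ N) (hK : 1 ≤ K) :
    StrictInclusion (sphereK N K) (sphereInfty N) := by
  obtain ⟨s, w, hs, hs2, hw, hw', hp, hsw, hne⟩ := exists_shift (K + 1) (by omega)
  exact strictInclusion_of_satisfies ((satisfies_coord _).sphereInfty_of_sphereK hK)
    (satisfies_sphereInfty_pythag hN hs hs2 hw hw' hsw)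
    fun h => hne (commute_of_commute_mul_pow (A := CStarMatrix (ZMod (K + 1)) (ZMod (K + 1)) ℂ)
      hw hw' hp (commute_pow_of_satisfies hN hK h))

open scoped ComplexOrder in
theorem strictInclusion_sphereInfty_sphereStar {N : ℕ} (hN : 2 ≤ N) :
    StrictInclusion (sphereInfty N) (sphereStar N) := by
  obtain ⟨s, w, hs, hs2, hw, hw', hne⟩ := exists_rotation
  exact strictInclusion_of_satisfies (satisfies_coord _).sphereStar_of_sphereInfty
    (satisfies_sphereStar_pythag hN hs hs2 hw hw')
    fun h => hne (commute_conj_of_satisfies (A := CStarMatrix (Fin 2) (Fin 2) ℂ) hN hs hw h)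

end NCSphere

theorem proposition8p2 (N : ℕ) (hN : 2 ≤ N) (K : ℕ) (hK : 1 ≤ K) :
    NCSphere.StrictInclusion (NCSphere.sphereK N K) (NCSphere.sphereInfty N) ∧
      NCSphere.StrictInclusion (NCSphere.sphereInfty N) (NCSphere.sphereStar N) :=
  ⟨NCSphere.strictInclusion_sphereK_sphereInfty hN hK,
    NCSphere.strictInclusion_sphereInfty_sphereStar hN⟩
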